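/- Let $A_1,\dots,A_6$ be six distinct points of the complex projective plane $\mathbb{P}^2$, the vertices of a hexagon. Let $L_j:\ell_j=0$ be the line through $A_j$ and $A_{j+1}$ for $j=1,\dots,6$ (the sides; indices modulo $6$), and let $L'_k:\ell'_k=0$ be the line through $A_k$ and $A_{k+3}$ for $k=1,2,3$ (the diagonals). Suppose that $A_1,\dots,A_6$ lie on a conic which is either smooth or a union of two distinct lines, and that the line arrangement $\mathcal{A}=L_1\cup\dots\cup L_6\cup L'_1\cup L'_2\cup L'_3$ has exactly $6$ triple points (points on exactly three of the lines) and exactly $18$ double points (points on exactly two of the lines). Let $S=\mathbb{C}[x,y,z]$, let $f=\ell_1\cdots\ell_6\,\ell'_1\ell'_2\ell'_3$ be the equation of $\mathcal{A}$, let $J=(f_x,f_y,f_z)\subset S$ be its Jacobian ideal, and let $I=\{g\in S:\ (x,y,z)^n g\subset J \text{ for some } n\ge 0\}$ be the saturation of $J$. Write $I_8$ and $J_8$ for the degree $8$ homogeneous parts of $I$ and $J$. Then there is a line $L:\ell=0$ through the three intersection points $L_k\cap L_{k+3}$, $k=1,2,3$, of opposite sides (the Pascal line). Moreover, for every equation $\ell=0$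 of such a line, there is a nonzero quartic form $q\in S$, homogeneous of degree $4$, vanishing at the $12$ points $A_j$ and $A'_j=L_j\cap L_{j+2}$, $j=1,\dots,6$ (indices modulo $6$), such that the octic form $$h=\ell\cdot\ell'_1\cdot\ell'_2\cdot\ell'_3\cdot q$$ belongs to $I_8$ but not to $J_8$. -/

import Mathlib

noncomputable section

namespace Hexagon

/-- The polynomial ring `ℂ[x, y, z]`. -/
abbrev S : Type := MvPolynomial (Fin 3) ℂ

/-- The complex projective plane. -/
abbrev P2 : Type := Projectivization ℂ (Fin 3 → ℂ)

/-- The plane curve `f = 0`: the points of the projective plane all of whose homogeneous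
coordinate vectors are zeros of `f`. -/
def curve (f : S) : Set P2 :=
  {p | ∀ (v : Fin 3 → ℂ) (hv : v ≠ 0), Projectivization.mk ℂ v hv = p → MvPolynomial.eval v f = 0}

/-- A nonzero linear form, that is, an equation of a line. -/
def IsLineForm (l : S) : Prop := l.IsHomogeneous 1 ∧ l ≠ 0

/-- `Q = 0` is a smooth conic. -/
def IsSmoothConic (Q : S) : Prop :=
  Q.IsHomogeneous 2 ∧ ∀ p ∈ curve Q, ∃ i, p ∉ curve (MvPolynomial.pderiv i Q)

/-- `Q = 0` is the union of two distinct lines. -/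
def IsTwoLines (Q : S) : Prop :=
  ∃ m n : S, IsLineForm m ∧ IsLineForm n ∧ curve m ≠ curve n ∧ Q = m * n

/-- The set of lines of the arrangement with the given family of equations. -/
def lineSet {ι : Type} (l : ι → S) : Set (Set P2) := Set.range fun i => curve (l i)

/-- The points lying on exactly `m` lines of the arrangement. -/
def multiplePoints {ι : Type} (l : ι → S) (m : ℕ) : Set P2 :=
  {p | {M ∈ lineSet l | p ∈ M}.ncard = m}

/-- The ideal generated by the first partial derivatives of `f`. -/
def jacobianIdeal (f : S) : Ideal S := Ideal.span (Set.range fun i => MvPolynomial.pderiv i f)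

/-- The saturation of `J` with respect to the maximal ideal `(x, y, z)`: the polynomials `g`
with `(x, y, z) ^ n * g ⊆ J` for some `n`. -/
def saturation (J : Ideal S) : Ideal S where
  carrier := {g | ∃ n : ℕ, ∀ a ∈ MvPolynomial.idealOfVars (Fin 3) ℂ ^ n, a * g ∈ J}
  zero_mem' := ⟨0, fun a _ => by simp⟩
  add_mem' := by
    rintro g h ⟨n, hn⟩ ⟨m, hm⟩
    refine ⟨n + m, fun a ha => ?_⟩
    rw [mul_add]
    exact J.add_mem (hn a (Ideal.pow_le_pow_right (Nat.le_add_right n m) ha))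
      (hm a (Ideal.pow_le_pow_right (Nat.le_add_left m n) ha))
  smul_mem' := by
    rintro c g ⟨n, hn⟩
    refine ⟨n, fun a ha => ?_⟩
    rw [smul_eq_mul, mul_left_comm]
    exact J.mul_mem_left c (hn a ha)

/-- The degree `k` part of an ideal: its elements that are homogeneous of degree `k`. -/
def degreePart (I : Ideal S) (k : ℕ) : Set S := {g | g ∈ I ∧ g.IsHomogeneous k}

/-- `l` is an equation of a line containing the intersection points of the three pairs of opposite
sides of the hexagon with sides `s j = 0`. -/
def IsPascalLine (s : Fin 6 → S) (l : S) : Prop :=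
  IsLineForm l ∧ ∀ k : Fin 3,
    curve (s (Fin.castAdd 3 k)) ∩ curve (s (Fin.natAdd 3 k)) ⊆ curve l

end Hexagon

end

noncomputable section

namespace Hexagon

open MvPolynomial Matrix

/-! Pascal's theorem gives a form `m` through the three intersections of opposite sides. Since no
three sides are concurrent, `m = ρ j • c j + ρ (j + 3) • c (j + 3)` with all `ρ j` nonzero. Give
side `j` the weight `(ρ j)⁻¹`, each diagonal the weight `0`, and form the sum of weight times
product of the other eight lines. Pairing opposite sides in this sum extracts `m` and the three
diagonals and leaves `hexagonQuartic` (`sum_weights_eq`).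

The sum imitates a directional derivative of `f`. It lies in the saturation if near each point some
vector `t` realises the weights of the lines through that point
(`sum_mul_prod_erase_mem_saturation`). At most two lines impose no condition. At a vertex the one
linear relation must respect the weights; by `diag_eq_smul` the diagonal is a multiple of `ρ j • c j
- ρ (j + 5) • c (j + 5)`, whose derivative along `t` is a multiple of 1 - 1 = 0.

If the octic were in `J`, its degree would make it a genuine directional derivative of `f` along
some `t`. Divisibility by each diagonal forces all diagonals to vanish at `t`; they are not
concurrent, so `t = 0` and the octic is zero, a contradiction.

The multiplicity hypotheses enter through a count: 6 · 3 + 18 = 36 exhausts the pairs among nine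
lines, so the lines are distinct and the vertices are the only points on three or more of them. -/

/-! ### Linear forms and cross products -/

/-- The linear form with coefficient vector `c`. -/
def linForm (c : Fin 3 → ℂ) : S := ∑ i, C (c i) * X i

@[simp]
lemma eval_linForm (c v : Fin 3 → ℂ) : eval v (linForm c) = c ⬝ᵥ v := by
  simp [linForm, dotProduct]

@[simp]
lemma pderiv_linForm (c : Fin 3 → ℂ) (i : Fin 3) : pderiv i (linForm c) = C (c i) := by
  simp [linForm, pderiv_X, Pi.single_apply]

lemma isHomogeneous_linForm (c : Fin 3 → ℂ) : (linForm c).IsHomogeneous 1 :=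
  IsHomogeneous.sum _ _ _ fun i _ => by
    simpa using (isHomogeneous_C _ (c i)).mul (isHomogeneous_X ℂ i)

lemma linForm_add (c d : Fin 3 → ℂ) : linForm (c + d) = linForm c + linForm d := by
  simp [linForm, add_mul, Finset.sum_add_distrib]

lemma linForm_smul (a : ℂ) (c : Fin 3 → ℂ) : linForm (a • c) = C a * linForm c := by
  simp [linForm, Finset.mul_sum, mul_assoc]

@[simp]
lemma linForm_zero : linForm 0 = 0 := by simp [linForm]

/-- The partial derivatives are constants, and Euler's identity reassembles the form from them. -/
lemma exists_eq_linForm {l : S} (h : l.IsHomogeneous 1) : ∃ c, l = linForm c := by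
  have h0 : ∀ i, ∃ a : ℂ, pderiv i l = C a := fun i => by
    have := (totalDegree_zero_iff_isHomogeneous _).2 (h.pderiv (i := i))
    exact ⟨_, totalDegree_eq_zero_iff_eq_C.1 this⟩
  choose c hc using h0
  refine ⟨c, ?_⟩
  have := h.sum_X_mul_pderiv
  simp only [hc, one_smul] at this
  rw [← this, linForm]
  exact Finset.sum_congr rfl fun i _ => mul_comm _ _

lemma IsLineForm.exists_eq_linForm {l : S} (h : IsLineForm l) : ∃ c, c ≠ 0 ∧ l = linForm c := by
  obtain ⟨c, rfl⟩ := Hexagon.exists_eq_linForm h.1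
  exact ⟨c, fun hc => h.2 (by simp [hc]), rfl⟩

lemma linForm_eq_zero_iff {c : Fin 3 → ℂ} : linForm c = 0 ↔ c = 0 := by
  refine ⟨fun h => funext fun i => ?_, fun h => by simp [h]⟩
  have := congrArg (pderiv i) h
  simpa using this

lemma isLineForm_linForm {c : Fin 3 → ℂ} (hc : c ≠ 0) : IsLineForm (linForm c) :=
  ⟨isHomogeneous_linForm c, fun h => hc (linForm_eq_zero_iff.1 h)⟩

lemma eval_smul_of_isHomogeneous {g : S} {n : ℕ} (hg : g.IsHomogeneous n) (a : ℂ)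
    (v : Fin 3 → ℂ) : eval (a • v) g = a ^ n * eval v g := by
  rw [eval_eq', eval_eq', Finset.mul_sum]
  refine Finset.sum_congr rfl fun m hm => ?_
  have hd := hg (mem_support_iff.1 hm)
  simp only [Pi.smul_apply, smul_eq_mul, mul_pow, Finset.prod_mul_distrib,
    Finset.prod_pow_eq_pow_sum]
  rw [Finsupp.weight_apply, Finsupp.sum_fintype _ _ (by simp)] at hd
  simp only [Pi.one_apply, smul_eq_mul, mul_one] at hd
  rw [hd]; ring

lemma mk_mem_curve_iff {g : S} {n : ℕ} (hg : g.IsHomogeneous n) {v : Fin 3 → ℂ} (hv : v ≠ 0) :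
    Projectivization.mk ℂ v hv ∈ curve g ↔ eval v g = 0 := by
  refine ⟨fun h => h v hv rfl, fun h w hw hwv => ?_⟩
  obtain ⟨a, rfl⟩ := (Projectivization.mk_eq_mk_iff' ℂ w v hw hv).1 hwv
  rw [eval_smul_of_isHomogeneous hg, h, mul_zero]

lemma mem_curve_iff {g : S} {n : ℕ} (hg : g.IsHomogeneous n) {p : P2} :
    p ∈ curve g ↔ eval p.rep g = 0 := by
  conv_lhs => rw [← p.mk_rep]
  exact mk_mem_curve_iff hg p.rep_nonzero

@[simp]
lemma mem_curve_linForm {c : Fin 3 → ℂ} {p : P2} : p ∈ curve (linForm c) ↔ c ⬝ᵥ p.rep = 0 := by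
  rw [mem_curve_iff (isHomogeneous_linForm c), eval_linForm]

/-- A vector orthogonal to two independent vectors is a multiple of their cross product. -/
lemma exists_eq_smul_cross {a b v : Fin 3 → ℂ} (hab : a ⨯₃ b ≠ 0) (ha : a ⬝ᵥ v = 0)
    (hb : b ⬝ᵥ v = 0) : ∃ r : ℂ, v = r • (a ⨯₃ b) := by
  have h : a ⨯₃ b ⨯₃ v = 0 := by
    rw [cross_cross_eq_smul_sub_smul, ha, hb]; simp
  obtain ⟨i, hi⟩ := Function.ne_iff.1 hab
  refine ⟨v i / (a ⨯₃ b) i, funext fun j => ?_⟩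
  simp only [Pi.zero_apply, Pi.smul_apply, smul_eq_mul] at hi ⊢
  rw [cross_apply] at h
  have h0 := congrFun h 0
  have h1 := congrFun h 1
  have h2 := congrFun h 2
  simp only [cons_val, Pi.zero_apply] at h0 h1 h2
  generalize a ⨯₃ b = w at *
  rw [div_mul_eq_mul_div, eq_div_iff hi]
  fin_cases i <;> fin_cases j <;> simp only [Fin.zero_eta, Fin.mk_one, Fin.reduceFinMk] <;>
    grind

lemma exists_eq_smul_of_cross_eq_zero {a b : Fin 3 → ℂ} (ha : a ≠ 0) (h : a ⨯₃ b = 0) :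
    ∃ r : ℂ, b = r • a := by
  by_contra hr
  push Not at hr
  refine (crossProduct_ne_zero_iff_linearIndependent.2 ?_) h
  exact (LinearIndependent.pair_iff' ha).2 fun r hr' => hr r hr'.symm

lemma cross_rep_ne_zero {p p' : P2} (h : p ≠ p') : p.rep ⨯₃ p'.rep ≠ 0 := by
  rw [crossProduct_ne_zero_iff_linearIndependent]
  have := (Projectivization.linearIndependent_pair_iff_ne (D := p) (D' := p')).2 h
  exact this

/-- Two linear forms vanishing at two distinct points are proportional. -/
lemma exists_eq_smul_of_vanish {a b c d : Fin 3 → ℂ} (hab : a ⨯₃ b ≠ 0) (hc : c ≠ 0)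
    (hca : c ⬝ᵥ a = 0) (hcb : c ⬝ᵥ b = 0) (hda : d ⬝ᵥ a = 0) (hdb : d ⬝ᵥ b = 0) :
    ∃ r : ℂ, d = r • c := by
  rw [dotProduct_comm] at hca hcb hda hdb
  obtain ⟨r, rfl⟩ := exists_eq_smul_cross hab hca hcb
  obtain ⟨t, rfl⟩ := exists_eq_smul_cross hab hda hdb
  have hr : r ≠ 0 := fun h => hc (by simp [h])
  exact ⟨t / r, by rw [smul_smul, div_mul_cancel₀ _ hr]⟩

lemma exists_dotProduct_eq {a b : Fin 3 → ℂ} (hab : a ⨯₃ b ≠ 0) (x y : ℂ) :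
    ∃ t : Fin 3 → ℂ, a ⬝ᵥ t = x ∧ b ⬝ᵥ t = y := by
  obtain ⟨i, hi⟩ := Function.ne_iff.1 hab
  -- `a`, `b`, `e` form a basis, so up to the determinant `b ⨯₃ e` and `e ⨯₃ a` are the vectors dual
  -- to `a` and `b`.
  set e : Fin 3 → ℂ := Pi.single i 1 with he
  have hd : e ⬝ᵥ a ⨯₃ b = (a ⨯₃ b) i := by simp [he]
  have hd' : e ⬝ᵥ a ⨯₃ b ≠ 0 := by rw [hd]; exact hi
  have h1 : a ⬝ᵥ b ⨯₃ e = e ⬝ᵥ a ⨯₃ b := (triple_product_permutation e a b).symm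
  have h2 : b ⬝ᵥ e ⨯₃ a = e ⬝ᵥ a ⨯₃ b := by
    rw [← h1, triple_product_permutation a]
  refine ⟨(e ⬝ᵥ a ⨯₃ b)⁻¹ • (x • (b ⨯₃ e) + y • (e ⨯₃ a)), ?_, ?_⟩
  · rw [dotProduct_smul, dotProduct_add, dotProduct_smul, dotProduct_smul, dot_cross_self, h1]
    simp only [smul_eq_mul]; field_simp; ring
  · rw [dotProduct_smul, dotProduct_add, dotProduct_smul, dotProduct_smul, dot_self_cross, h2]
    simp only [smul_eq_mul]; field_simp; ring

/-- A linear form vanishing at the intersection point of two lines is a combination of their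
equations. -/
lemma exists_eq_add_of_dotProduct_cross_eq_zero {a b c : Fin 3 → ℂ} (hab : a ⨯₃ b ≠ 0)
    (hc : c ⬝ᵥ a ⨯₃ b = 0) : ∃ x y : ℂ, c = x • a + y • b := by
  obtain ⟨i, hi⟩ := Function.ne_iff.1 hab
  rw [Pi.zero_apply] at hi
  refine ⟨(c ⨯₃ b) ⬝ᵥ Pi.single i 1 / (a ⨯₃ b) i, (a ⨯₃ c) ⬝ᵥ Pi.single i 1 / (a ⨯₃ b) i,
    funext fun j => ?_⟩
  simp only [cross_apply, vec3_dotProduct, cons_val, dotProduct_single, mul_one] at hc hi ⊢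
  simp only [Pi.add_apply, Pi.smul_apply, smul_eq_mul]
  fin_cases i <;> fin_cases j <;> simp at hi hc ⊢ <;> field_simp <;> grind


/-! ### Derivations and the saturated Jacobian ideal -/

/-- The derivation along the constant vector field `t`. -/
def dirDeriv (t : Fin 3 → ℂ) : Derivation ℂ S S := mkDerivation ℂ fun i => C (t i)

lemma dirDeriv_eq_sum (t : Fin 3 → ℂ) (g : S) : dirDeriv t g = ∑ i, C (t i) * pderiv i g := by
  have : dirDeriv t = ∑ i, t i • (pderiv i : Derivation ℂ S S) := by
    refine derivation_ext fun j => ?_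
    have h : (∑ i, t i • (pderiv i : Derivation ℂ S S)) (X j) = ∑ i, t i • pderiv i (X j : S) := by
      simp [Fin.sum_univ_three]
    rw [h]
    simp [dirDeriv, pderiv_X, Pi.single_apply, smul_eq_C_mul]
  rw [this]
  simp [Fin.sum_univ_three, smul_eq_C_mul]

@[simp]
lemma dirDeriv_linForm (t c : Fin 3 → ℂ) : dirDeriv t (linForm c) = C (c ⬝ᵥ t) := by
  simp [dirDeriv_eq_sum, dotProduct, mul_comm]

lemma derivation_prod {ι : Type*} [DecidableEq ι] (D : Derivation ℂ S S) (s : Finset ι)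
    (g : ι → S) : D (∏ i ∈ s, g i) = ∑ i ∈ s, D (g i) * ∏ j ∈ s.erase i, g j := by
  induction s using Finset.induction_on with
  | empty => simp
  | insert a s ha ih =>
    rw [Finset.prod_insert ha, D.leibniz, ih, Finset.sum_insert ha, Finset.erase_insert ha,
      smul_eq_mul, smul_eq_mul, Finset.mul_sum, add_comm, mul_comm]
    congr 1
    refine Finset.sum_congr rfl fun i hi => ?_
    have hne : a ≠ i := fun h => ha (h ▸ hi)
    rw [Finset.erase_insert_of_ne hne, Finset.prod_insert (fun h => ha (Finset.mem_of_mem_erase h))]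
    ring

lemma dirDeriv_mem_jacobianIdeal (t : Fin 3 → ℂ) (f : S) : dirDeriv t f ∈ jacobianIdeal f := by
  rw [dirDeriv_eq_sum]
  exact Ideal.sum_mem _ fun i _ => Ideal.mul_mem_left _ _ (Ideal.subset_span ⟨i, rfl⟩)

lemma self_mem_jacobianIdeal {f : S} {n : ℕ} (hn : n ≠ 0) (hf : f.IsHomogeneous n) :
    f ∈ jacobianIdeal f := by
  have h : (C (n : ℂ)) * f ∈ jacobianIdeal f := by
    have := hf.sum_X_mul_pderiv
    rw [nsmul_eq_mul] at this
    rw [map_natCast, ← this]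
    exact Ideal.sum_mem _ fun i _ => Ideal.mul_mem_left _ _ (Ideal.subset_span ⟨i, rfl⟩)
  have h2 := Ideal.mul_mem_left _ (C ((n : ℂ)⁻¹)) h
  rwa [← mul_assoc, ← C_mul, inv_mul_cancel₀ (by exact_mod_cast hn), C_1, one_mul] at h2

/-- By the Nullstellensatz, `h` is in the saturation of `J` as soon as the quotient ideal `J : h`
has no zero in the projective plane. -/
lemma mem_saturation_of_forall_exists {J : Ideal S} {h : S}
    (H : ∀ v : Fin 3 → ℂ, v ≠ 0 → ∃ g : S, eval v g ≠ 0 ∧ g * h ∈ J) : h ∈ saturation J := by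
  let K : Ideal S := J.colon {h}
  have hK : ∀ g, g ∈ K ↔ g * h ∈ J := fun g => by simp [K, Submodule.mem_colon_singleton]
  have hrad : idealOfVars (Fin 3) ℂ ≤ K.radical := by
    rw [← vanishingIdeal_zeroLocus_eq_radical (K := ℂ), idealOfVars, Ideal.span_le]
    rintro _ ⟨i, rfl⟩
    rw [SetLike.mem_coe, mem_vanishingIdeal_iff]
    intro v hv
    rw [mem_zeroLocus_iff] at hv
    have hv0 : v = 0 := by
      by_contra hne
      obtain ⟨g, hg, hgJ⟩ := H v hne
      exact hg (by simpa [aeval_eq_eval] using hv g ((hK g).2 hgJ))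
    simp [hv0]
  obtain ⟨n, hn⟩ := Ideal.exists_pow_le_of_le_radical_of_fg hrad (idealOfVars_fg _ _)
  exact ⟨n, fun a ha => (hK a).1 (hn ha)⟩

lemma isHomogeneous_prod_linForm {ι : Type*} (w : ι → Fin 3 → ℂ) (s : Finset ι) :
    (∏ i ∈ s, linForm (w i)).IsHomogeneous s.card := by
  simpa using IsHomogeneous.prod s (fun i => linForm (w i)) (fun _ => 1)
    fun i _ => isHomogeneous_linForm (w i)

section Arrangement

variable {ι : Type*} [Fintype ι] [DecidableEq ι]

/-- The polynomial `∑ e i * ∏_{j ≠ i} l j` attached to weights `e i` on the lines of an arrangement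
is in the saturated Jacobian ideal, provided that at each point the weights on the lines through
that point are the derivatives of their equations along a vector. -/
lemma sum_mul_prod_erase_mem_saturation [Nonempty ι] (w : ι → Fin 3 → ℂ) (e : ι → ℂ)
    (H : ∀ v : Fin 3 → ℂ, v ≠ 0 → ∃ t : Fin 3 → ℂ, ∀ i, w i ⬝ᵥ v = 0 → w i ⬝ᵥ t = e i) :
    ∑ i, C (e i) * ∏ j ∈ Finset.univ.erase i, linForm (w j) ∈
      saturation (jacobianIdeal (∏ i, linForm (w i))) := by
  refine mem_saturation_of_forall_exists fun v hv => ?_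
  obtain ⟨t, ht⟩ := H v hv
  set F : S := ∏ i, linForm (w i) with hF
  have hFJ : F ∈ jacobianIdeal F :=
    self_mem_jacobianIdeal Fintype.card_ne_zero (isHomogeneous_prod_linForm w Finset.univ)
  classical
  -- The multiplier is the product of the lines missing `v`: it is nonzero at `v`, and it supplies
  -- the factor absent from each term whose weight `t` fails to realise, making that term a multiple
  -- of `F`.
  set T : Finset ι := Finset.univ.filter fun i => w i ⬝ᵥ v ≠ 0 with hT
  refine ⟨∏ i ∈ T, linForm (w i), ?_, ?_⟩
  · rw [eval_prod]
    refine Finset.prod_ne_zero_iff.2 fun i hi => ?_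
    simpa [hT] using hi
  · have key : (∑ i, C (e i) * ∏ j ∈ Finset.univ.erase i, linForm (w j)) = dirDeriv t F +
        ∑ i, C (e i - w i ⬝ᵥ t) * ∏ j ∈ Finset.univ.erase i, linForm (w j) := by
      rw [hF, derivation_prod, ← Finset.sum_add_distrib]
      refine Finset.sum_congr rfl fun i _ => ?_
      rw [dirDeriv_linForm, C_sub]; ring
    rw [key, mul_add]
    refine Ideal.add_mem _ (Ideal.mul_mem_left _ _ (dirDeriv_mem_jacobianIdeal t F)) ?_
    rw [Finset.mul_sum]
    refine Ideal.sum_mem _ fun i _ => ?_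
    by_cases hi : w i ⬝ᵥ v = 0
    · simp [ht i hi]
    · have hiT : i ∈ T := by simpa [hT] using hi
      have : (∏ i ∈ T, linForm (w i)) *
          (C (e i - w i ⬝ᵥ t) * ∏ j ∈ Finset.univ.erase i, linForm (w j)) =
          C (e i - w i ⬝ᵥ t) * (∏ j ∈ T.erase i, linForm (w j)) * F := by
        rw [hF, ← Finset.mul_prod_erase T _ hiT,
          ← Finset.mul_prod_erase Finset.univ (fun i => linForm (w i)) (Finset.mem_univ i)]
        ring
      rw [this]
      exact Ideal.mul_mem_left _ _ hFJ

end Arrangement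

/-! ### The Jacobian ideal in its initial degree -/

/-- In its initial degree, the Jacobian ideal consists of the directional derivatives. -/
lemma exists_eq_dirDeriv_of_mem_jacobianIdeal {f h : S} {n : ℕ} (hf : f.IsHomogeneous (n + 1))
    (hh : h.IsHomogeneous n) (hJ : h ∈ jacobianIdeal f) : ∃ t, h = dirDeriv t f := by
  obtain ⟨c, hc⟩ := (Ideal.mem_span_range_iff_exists_fun).1 hJ
  refine ⟨fun i => coeff 0 (c i), ?_⟩
  let _ := MvPolynomial.gradedAlgebra (σ := Fin 3) (R := ℂ)
  -- The partials already have degree `n`, so only the constant term of each coefficient survives in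
  -- degree `n`.
  have hcomp : ∀ i, homogeneousComponent n (c i * pderiv i f) =
      C (coeff 0 (c i)) * pderiv i f := fun i => by
    have hp : pderiv i f ∈ homogeneousSubmodule (Fin 3) ℂ n := by
      have := hf.pderiv (i := i)
      simpa using this
    have := DirectSum.coe_decompose_mul_add_of_right_mem (homogeneousSubmodule (Fin 3) ℂ)
      (i := 0) (a := c i) hp
    rw [zero_add] at this
    have hd : ∀ (φ : S) (i : ℕ), (DirectSum.decompose (homogeneousSubmodule (Fin 3) ℂ) φ i : S) =
        homogeneousComponent i φ := fun φ i => decomposition.decompose'_apply φ i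
    rw [← homogeneousComponent_zero, ← hd, this, hd]
  rw [← homogeneousComponent_eq_self hh, ← hc, map_sum, dirDeriv_eq_sum]
  exact Finset.sum_congr rfl fun i _ => hcomp i

lemma prime_linForm {c : Fin 3 → ℂ} (hc : c ≠ 0) : Prime (linForm c) := by
  refine Irreducible.prime (irreducible_of_totalDegree_eq_one
    ((isHomogeneous_linForm c).totalDegree fun h => hc (linForm_eq_zero_iff.1 h)) fun x hx => ?_)
  refine isUnit_iff_ne_zero.2 fun h0 => hc (linForm_eq_zero_iff.1 ?_)
  ext i
  simpa [h0] using hx i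

lemma cross_eq_zero_of_linForm_dvd {c d : Fin 3 → ℂ} (h : linForm c ∣ linForm d) :
    c ⨯₃ d = 0 := by
  by_contra hcd
  obtain ⟨t, ht0, ht1⟩ := exists_dotProduct_eq hcd 0 1
  obtain ⟨g, hg⟩ := h
  have := congrArg (eval t) hg
  simp [ht0, ht1] at this

/-- If the derivative of an arrangement along `t` is divisible by one of the lines, then that line
is invariant under translation by `t`. -/
lemma dotProduct_eq_zero_of_dvd_dirDeriv {ι : Type*} [Fintype ι] [DecidableEq ι]
    {w : ι → Fin 3 → ℂ} {t : Fin 3 → ℂ} {i : ι} (hi : w i ≠ 0)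
    (hw : ∀ j ≠ i, w i ⨯₃ w j ≠ 0)
    (h : linForm (w i) ∣ dirDeriv t (∏ j, linForm (w j))) : w i ⬝ᵥ t = 0 := by
  by_contra hne
  -- Modulo the line `i`, the derivative reduces to the constant `w i ⬝ᵥ t` times the product of the
  -- other lines, none of which this prime form divides.
  rw [← Finset.mul_prod_erase Finset.univ _ (Finset.mem_univ i), Derivation.leibniz, smul_eq_mul,
    smul_eq_mul, dvd_add_right (dvd_mul_right _ _), dirDeriv_linForm] at h
  have hu : IsUnit (C (w i ⬝ᵥ t) : S) := (isUnit_iff_ne_zero.2 hne).map C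
  rw [hu.dvd_mul_right, (prime_linForm hi).dvd_finsetProd_iff] at h
  obtain ⟨j, hj, hd⟩ := h
  exact hw j (Finset.ne_of_mem_erase hj) (cross_eq_zero_of_linForm_dvd hd)


/-! ### Counting incidences -/

/-- Nine or fewer lines with six triple points and eighteen double points are nine lines, and have
no points of higher multiplicity. -/
lemma card_eq_nine_of_multiplePoints {P : Type*} (𝓛 : Finset (Set P)) (h9 : 𝓛.card ≤ 9)
    (hsub : ∀ M ∈ 𝓛, ∀ N ∈ 𝓛, M ≠ N → (M ∩ N).Subsingleton)
    (h3 : {p : P | {M ∈ (𝓛 : Set (Set P)) | p ∈ M}.ncard = 3}.ncard = 6)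
    (h2 : {p : P | {M ∈ (𝓛 : Set (Set P)) | p ∈ M}.ncard = 2}.ncard = 18) :
    𝓛.card = 9 ∧ ∀ p : P, {M ∈ (𝓛 : Set (Set P)) | p ∈ M}.ncard ≤ 3 := by
  classical
  set K : P → Finset (Set P) := fun p => 𝓛.filter fun M => p ∈ M with hK
  have hm : ∀ p, {M ∈ (𝓛 : Set (Set P)) | p ∈ M}.ncard = (K p).card := fun p => by
    rw [← Set.ncard_coe_finset]; simp [hK]
  simp only [hm] at h3 h2 ⊢
  have Fh3 := Set.finite_of_ncard_ne_zero (h3.trans_ne (by norm_num))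
  have Fh2 := Set.finite_of_ncard_ne_zero (h2.trans_ne (by norm_num))
  set T := Fh3.toFinset with hT
  set D := Fh2.toFinset with hD
  have hTc : T.card = 6 := by rw [hT, ← Set.ncard_eq_toFinset_card _ Fh3, h3]
  have hDc : D.card = 18 := by rw [hD, ← Set.ncard_eq_toFinset_card _ Fh2, h2]
  have hT' : ∀ p, p ∈ T ↔ (K p).card = 3 := fun p => by simp [hT]
  have hD' : ∀ p, p ∈ D ↔ (K p).card = 2 := fun p => by simp [hD]
  have hTD : Disjoint T D := Finset.disjoint_left.2 fun p h h' => by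
    rw [hT'] at h; rw [hD'] at h'; omega
  -- Two distinct lines share at most one point, so ordered pairs of lines are counted at one point
  -- only.
  have hdisj : ∀ p p' : P, p ≠ p' → Disjoint (K p).offDiag (K p').offDiag := by
    intro p p' hpp'
    refine Finset.disjoint_left.2 fun x hx hx' => hpp' ?_
    simp only [hK, Finset.mem_offDiag, Finset.mem_filter] at hx hx'
    exact hsub _ hx.1.1 _ hx.2.1.1 hx.2.2 ⟨hx.1.2, hx.2.1.2⟩ ⟨hx'.1.2, hx'.2.1.2⟩
  have hoff : ∀ U : Finset P, ∑ p ∈ U, (K p).offDiag.card ≤ 𝓛.card * 𝓛.card - 𝓛.card := by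
    intro U
    rw [← Finset.card_biUnion fun p _ p' _ h => hdisj p p' h, ← Finset.offDiag_card]
    refine Finset.card_le_card (Finset.biUnion_subset.2 fun p _ => ?_)
    exact Finset.offDiag_mono (Finset.filter_subset _ _)
  have hsumT : ∑ p ∈ T, (K p).offDiag.card = 36 := by
    rw [Finset.sum_congr rfl fun p hp => by rw [Finset.offDiag_card, (hT' p).1 hp],
      Finset.sum_const, hTc]
    rfl
  have hsumD : ∑ p ∈ D, (K p).offDiag.card = 36 := by
    rw [Finset.sum_congr rfl fun p hp => by rw [Finset.offDiag_card, (hD' p).1 hp],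
      Finset.sum_const, hDc]
    rfl
  have hsum : ∑ p ∈ T ∪ D, (K p).offDiag.card = 72 := by
    rw [Finset.sum_union hTD, hsumT, hsumD]
  have h72 := hoff (T ∪ D)
  rw [hsum] at h72
  have hc9 : 𝓛.card = 9 := by
    generalize 𝓛.card = n at *
    interval_cases n <;> omega
  refine ⟨hc9, fun p => ?_⟩
  by_contra hp
  push Not at hp
  have hpn : p ∉ T ∪ D := by
    rw [Finset.mem_union, hT', hD']; omega
  -- All 72 ordered pairs are already used; a point on four or more lines would add at least 12.
  have := hoff (insert p (T ∪ D))
  rw [Finset.sum_insert hpn, hsum, hc9, Finset.offDiag_card] at this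
  have h4 : 4 * (K p).card ≤ (K p).card * (K p).card := Nat.mul_le_mul_right _ hp
  omega

lemma inter_subsingleton {c c' : Fin 3 → ℂ} (hc : c ≠ 0) (hc' : c' ≠ 0)
    (h : curve (linForm c) ≠ curve (linForm c')) :
    (curve (linForm c) ∩ curve (linForm c')).Subsingleton := by
  rintro p ⟨hp, hp'⟩ r ⟨hr, hr'⟩
  rw [mem_curve_linForm] at hp hp' hr hr'
  by_contra hpr
  obtain ⟨a, rfl⟩ := exists_eq_smul_of_vanish (cross_rep_ne_zero hpr) hc hp hr hp' hr'
  have ha : a ≠ 0 := fun h0 => hc' (by simp [h0])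
  exact h (Set.ext fun x => by simp [ha])

/-- The index of the diagonal through a vertex of the hexagon. -/
def diagIndex (j : Fin 6) : Fin 3 := Fin.ofNat 3 j

/-- The indices of the two sides and of the diagonal through a vertex of the hexagon. -/
def linesThrough (j : Fin 6) : Finset (Fin 6 ⊕ Fin 3) :=
  -- `j + 5` is `j - 1` modulo 6.
  {Sum.inl (j + 5), Sum.inl j, Sum.inr (diagIndex j)}

/-- The incidences of a hexagonal arrangement which has only the obvious multiple points. -/
structure IsGenericHexagon (A : Fin 6 → P2) (w : Fin 6 ⊕ Fin 3 → Fin 3 → ℂ) : Prop where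
  cross_ne_zero : ∀ i i', i ≠ i' → w i ⨯₃ w i' ≠ 0
  vertex_mem_iff : ∀ j i, w i ⬝ᵥ (A j).rep = 0 ↔ i ∈ linesThrough j
  eq_vertex : ∀ v : Fin 3 → ℂ, v ≠ 0 → ∀ i₁ i₂ i₃, i₁ ≠ i₂ → i₁ ≠ i₃ → i₂ ≠ i₃ →
    w i₁ ⬝ᵥ v = 0 → w i₂ ⬝ᵥ v = 0 → w i₃ ⬝ᵥ v = 0 →
    ∃ (j : Fin 6) (r : ℂ), r ≠ 0 ∧ v = r • (A j).rep

/-- With multiplicities at most three, the three known lines through a vertex are all of them; the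
six distinct vertices then exhaust the six triple points. -/
lemma isGenericHexagon (A : Fin 6 → P2) (hA : Function.Injective A)
    (w : Fin 6 ⊕ Fin 3 → Fin 3 → ℂ) (hw : ∀ i, w i ≠ 0)
    (hinc : ∀ j, ∀ i ∈ linesThrough j, A j ∈ curve (linForm (w i)))
    (htriple : (multiplePoints (fun i => linForm (w i)) 3).ncard = 6)
    (hdouble : (multiplePoints (fun i => linForm (w i)) 2).ncard = 18) :
    IsGenericHexagon A w := by
  classical
  set L : Fin 6 ⊕ Fin 3 → Set P2 := fun i => curve (linForm (w i)) with hL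
  set 𝓛 : Finset (Set P2) := Finset.univ.image L with h𝓛
  have hset : lineSet (fun i => linForm (w i)) = (𝓛 : Set (Set P2)) := by
    simp [lineSet, h𝓛, hL]
  simp only [multiplePoints, hset] at htriple hdouble
  obtain ⟨h9, hle⟩ := card_eq_nine_of_multiplePoints 𝓛 Finset.card_image_le (by
    intro M hM N hN hMN
    obtain ⟨i, -, rfl⟩ := Finset.mem_image.1 hM
    obtain ⟨i', -, rfl⟩ := Finset.mem_image.1 hN
    exact inter_subsingleton (hw i) (hw i') hMN) htriple hdouble
  have hinj : Function.Injective L := by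
    have : (Finset.univ.image L).card = (Finset.univ : Finset (Fin 6 ⊕ Fin 3)).card := h9
    simpa [Set.injOn_univ] using Finset.card_image_iff.1 this
  set K : P2 → Finset (Fin 6 ⊕ Fin 3) := fun p => Finset.univ.filter fun i => p ∈ L i with hK
  have hKm : ∀ p, {M ∈ (𝓛 : Set (Set P2)) | p ∈ M}.ncard = (K p).card := fun p => by
    rw [← Finset.card_image_of_injective _ hinj, ← Set.ncard_coe_finset]
    congr 1
    ext M
    simp only [h𝓛, hK, Set.mem_ofPred_eq, Finset.mem_coe, Finset.mem_image, Finset.mem_univ,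
      true_and, Finset.mem_filter]
    constructor
    · rintro ⟨⟨i, rfl⟩, hp⟩; exact ⟨i, hp, rfl⟩
    · rintro ⟨i, hp, rfl⟩; exact ⟨⟨i, rfl⟩, hp⟩
  simp only [hKm] at hle htriple hdouble
  have hcard : ∀ j, (linesThrough j).card = 3 := by decide
  have hKA : ∀ j, K (A j) = linesThrough j := fun j => by
    refine (Finset.eq_of_subset_of_card_le (fun i hi => ?_) ?_).symm
    · simpa only [hK, Finset.mem_filter, Finset.mem_univ, true_and] using hinc j i hi
    · rw [hcard]; exact hle _
  have hTA : ∀ p, (K p).card = 3 → p ∈ Set.range A := by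
    have hfin := Set.finite_of_ncard_ne_zero (htriple.trans_ne (by norm_num))
    have hsub : Set.range A ⊆ {p | (K p).card = 3} := by
      rintro _ ⟨j, rfl⟩
      rw [Set.mem_ofPred_eq, hKA, hcard]
    have hr : (Set.range A).ncard = 6 := by
      rw [← Set.image_univ, Set.ncard_image_of_injective _ hA]; simp
    have := Set.eq_of_subset_of_ncard_le hsub (by rw [htriple, hr]) hfin
    intro p hp
    rw [this]; exact hp
  refine ⟨fun i i' hii' h0 => hii' (hinj ?_), fun j i => ?_, ?_⟩
  · obtain ⟨r, hr⟩ := exists_eq_smul_of_cross_eq_zero (hw i) h0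
    have hr0 : r ≠ 0 := fun h => hw i' (by simp [hr, h])
    exact Set.ext fun x => by simp [hL, hr, hr0]
  · rw [← hKA]; simp [hK, hL]
  · intro v hv i₁ i₂ i₃ h12 h13 h23 h1 h2 h3
    have hmem : ∀ i, w i ⬝ᵥ v = 0 → i ∈ K (Projectivization.mk ℂ v hv) := fun i hi => by
      simp only [hK, hL, Finset.mem_filter, Finset.mem_univ, true_and]
      rw [mk_mem_curve_iff (isHomogeneous_linForm _), eval_linForm, hi]
    have hsub : ({i₁, i₂, i₃} : Finset (Fin 6 ⊕ Fin 3)) ⊆ K (Projectivization.mk ℂ v hv) := by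
      intro i hi
      simp only [Finset.mem_insert, Finset.mem_singleton] at hi
      rcases hi with rfl | rfl | rfl
      exacts [hmem _ h1, hmem _ h2, hmem _ h3]
    have hc := Finset.card_le_card hsub
    rw [Finset.card_eq_three.2 ⟨i₁, i₂, i₃, h12, h13, h23, rfl⟩] at hc
    obtain ⟨j, hj⟩ := hTA _ (le_antisymm (hle _) hc)
    rw [← (A j).mk_rep, Projectivization.mk_eq_mk_iff' ] at hj
    obtain ⟨r, hr⟩ := hj
    have hr0 : r ≠ 0 := fun h => (A j).rep_nonzero (by simp [← hr, h])
    exact ⟨j, r⁻¹, inv_ne_zero hr0, by rw [← hr, smul_smul, inv_mul_cancel₀ hr0, one_smul]⟩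


/-! ### Pascal's theorem -/

/-- Euler's identity in degree 2: the rows of `M` are the coefficients of the partial derivatives.
-/
lemma exists_two_mul_eval_eq {Q : S} (hQ : Q.IsHomogeneous 2) :
    ∃ M : Matrix (Fin 3) (Fin 3) ℂ, ∀ v, 2 * eval v Q = v ⬝ᵥ M *ᵥ v := by
  have h : ∀ i, ∃ c, pderiv i Q = linForm c := fun i => exists_eq_linForm (hQ.pderiv (i := i))
  choose c hc using h
  refine ⟨Matrix.of c, fun v => ?_⟩
  have := congrArg (eval v) hQ.sum_X_mul_pderiv
  simp only [hc, map_sum, map_mul, eval_X, eval_linForm, nsmul_eq_mul, map_natCast] at this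
  rw [Nat.cast_ofNat] at this
  rw [← this]
  rfl

lemma cross_mulVec_ne_zero {P P' : Matrix (Fin 3) (Fin 3) ℂ} (h : P' * P = 1)
    {a b : Fin 3 → ℂ} (hab : a ⨯₃ b ≠ 0) : (P *ᵥ a) ⨯₃ (P *ᵥ b) ≠ 0 := by
  intro h0
  have hP : ∀ x, P' *ᵥ (P *ᵥ x) = x := fun x => by rw [mulVec_mulVec, h, one_mulVec]
  have ha : P *ᵥ a ≠ 0 := fun ha => hab (by rw [← hP a, ha]; simp)
  obtain ⟨r, hr⟩ := exists_eq_smul_of_cross_eq_zero ha h0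
  have : b = r • a := by rw [← hP b, hr, mulVec_smul, hP]
  exact hab (by simp [this, cross_self])

/-- Pascal's theorem for a hexagon whose first three vertices are the coordinate points. -/
lemma det_cross_cross_eq_zero {u : Fin 6 → Fin 3 → ℂ} (h0 : u 0 = ![1, 0, 0])
    (h1 : u 1 = ![0, 1, 0]) (h2 : u 2 = ![0, 0, 1]) {α : Fin 3 → ℂ} (hα : α ≠ 0)
    (hu : ∀ j, α 0 * (u j 1 * u j 2) + α 1 * (u j 0 * u j 2) + α 2 * (u j 0 * u j 1) = 0) :
    (Matrix.of fun k : Fin 3 =>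
      (u (Fin.castAdd 3 k) ⨯₃ u (Fin.castAdd 3 k + 1)) ⨯₃
        (u (Fin.natAdd 3 k) ⨯₃ u (Fin.natAdd 3 k + 1))).det = 0 := by
  have hN : (Matrix.of fun k : Fin 3 => ![u (Fin.natAdd 3 k) 1 * u (Fin.natAdd 3 k) 2,
      u (Fin.natAdd 3 k) 0 * u (Fin.natAdd 3 k) 2,
      u (Fin.natAdd 3 k) 0 * u (Fin.natAdd 3 k) 1]).det = 0 := by
    refine Matrix.exists_mulVec_eq_zero_iff.1 ⟨α, hα, funext fun k => ?_⟩
    simp only [mulVec, vec3_dotProduct, of_apply, cons_val, Pi.zero_apply]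
    linear_combination hu (Fin.natAdd 3 k)
  have e0 : Fin.castAdd 3 (0 : Fin 3) = (0 : Fin 6) := rfl
  have e1 : Fin.castAdd 3 (1 : Fin 3) = (1 : Fin 6) := rfl
  have e2 : Fin.castAdd 3 (2 : Fin 3) = (2 : Fin 6) := rfl
  have e3 : Fin.natAdd 3 (0 : Fin 3) = (3 : Fin 6) := rfl
  have e4 : Fin.natAdd 3 (1 : Fin 3) = (4 : Fin 6) := rfl
  have e5 : Fin.natAdd 3 (2 : Fin 3) = (5 : Fin 6) := rfl
  have f1 : (0 + 1 : Fin 6) = 1 := rfl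
  have f2 : (1 + 1 : Fin 6) = 2 := rfl
  have f3 : (2 + 1 : Fin 6) = 3 := rfl
  have f4 : (3 + 1 : Fin 6) = 4 := rfl
  have f5 : (4 + 1 : Fin 6) = 5 := rfl
  have f6 : (5 + 1 : Fin 6) = 0 := rfl
  rw [det_fin_three] at hN ⊢
  simp only [of_apply, e0, e1, e2, e3, e4, e5, f1, f2, f3, f4, f5, f6, h0, h1, h2, cross_apply,
    cons_val] at hN ⊢
  linear_combination -hN

/-- Pascal's theorem: the intersection points of the opposite sides of a hexagon inscribed in a
conic are collinear. -/
lemma exists_dotProduct_cross_eq_zero {a c : Fin 6 → Fin 3 → ℂ} {Q : S} (hQ : Q.IsHomogeneous 2)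
    (hQ0 : Q ≠ 0) (hQa : ∀ j, eval (a j) Q = 0) (hca : ∀ j, c j ⬝ᵥ a j = 0)
    (hca' : ∀ j, c j ⬝ᵥ a (j + 1) = 0) (ha : ∀ j, a j ⨯₃ a (j + 1) ≠ 0)
    (hc : ∀ j, c j ≠ 0)
    (hcc : ∀ k : Fin 3, c (Fin.castAdd 3 k) ⨯₃ c (Fin.natAdd 3 k) ≠ 0) (h2 : c 0 ⬝ᵥ a 2 ≠ 0) :
    ∃ l : Fin 3 → ℂ, l ≠ 0 ∧
      ∀ k : Fin 3, l ⬝ᵥ c (Fin.castAdd 3 k) ⨯₃ c (Fin.natAdd 3 k) = 0 := by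
  -- Coordinates in which the first three vertices are the coordinate points; `h2` makes them
  -- independent.
  set P : Matrix (Fin 3) (Fin 3) ℂ := (Matrix.of ![a 0, a 1, a 2])ᵀ with hP
  have hdet : P.det ≠ 0 := by
    have h0 : c 0 ⬝ᵥ a 0 = 0 := hca 0
    have h1 : c 0 ⬝ᵥ a 1 = 0 := hca' 0
    rw [dotProduct_comm] at h0 h1
    obtain ⟨r, hr⟩ := exists_eq_smul_cross (ha 0) h0 h1
    have hd : P.det = a 2 ⬝ᵥ a 0 ⨯₃ a 1 := by
      rw [hP, det_transpose, triple_product_permutation]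
      exact (triple_product_eq_det _ _ _).symm
    rw [hd]
    intro h
    apply h2
    rw [hr, smul_dotProduct, dotProduct_comm]
    exact (congrArg (r • ·) h).trans (smul_zero r)
  have hu : IsUnit P.det := isUnit_iff_ne_zero.2 hdet
  have hPl : P⁻¹ * P = 1 := nonsing_inv_mul P hu
  have hPr : P * P⁻¹ = 1 := mul_nonsing_inv P hu
  have hPl' : ∀ x, P⁻¹ *ᵥ (P *ᵥ x) = x := fun x => by rw [mulVec_mulVec, hPl, one_mulVec]
  have hPr' : ∀ x, P *ᵥ (P⁻¹ *ᵥ x) = x := fun x => by rw [mulVec_mulVec, hPr, one_mulVec]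
  set u : Fin 6 → Fin 3 → ℂ := fun j => P⁻¹ *ᵥ a j
  have hPu : ∀ j, P *ᵥ u j = a j := fun j => hPr' _
  set σ : Fin 6 → Fin 3 → ℂ := fun j => Pᵀ *ᵥ c j with hσ
  have hσx : ∀ j x, σ j ⬝ᵥ x = c j ⬝ᵥ P *ᵥ x := fun j x => by
    rw [hσ, dotProduct_mulVec]
    simp only [mulVec_transpose]
  have hτ : ∀ j, u j ⨯₃ u (j + 1) ≠ 0 := fun j => cross_mulVec_ne_zero hPr (ha j)
  have hσ0 : ∀ j, σ j ≠ 0 := fun j h => hc j (by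
    have := congrArg (P⁻¹ᵀ *ᵥ ·) h
    simpa [hσ, mulVec_mulVec, ← transpose_mul, hPr] using this)
  have hστ : ∀ j, ∃ r : ℂ, r ≠ 0 ∧ σ j = r • (u j ⨯₃ u (j + 1)) := fun j => by
    obtain ⟨r, hr⟩ := exists_eq_smul_cross (hτ j) (v := σ j)
      (by rw [dotProduct_comm, hσx, hPu, hca]) (by rw [dotProduct_comm, hσx, hPu, hca'])
    exact ⟨r, fun h => hσ0 j (by simp [hr, h]), hr⟩
  have h0 : u 0 = ![1, 0, 0] := by
    have : P *ᵥ ![1, 0, 0] = a 0 := by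
      ext i; fin_cases i <;> simp [hP, mulVec]
    rw [show u 0 = P⁻¹ *ᵥ a 0 from rfl, ← this]; exact hPl' _
  have h1 : u 1 = ![0, 1, 0] := by
    have : P *ᵥ ![0, 1, 0] = a 1 := by
      ext i; fin_cases i <;> simp [hP, mulVec]
    rw [show u 1 = P⁻¹ *ᵥ a 1 from rfl, ← this]; exact hPl' _
  have h2 : u 2 = ![0, 0, 1] := by
    have : P *ᵥ ![0, 0, 1] = a 2 := by
      ext i; fin_cases i <;> simp [hP, mulVec]
    rw [show u 2 = P⁻¹ *ᵥ a 2 from rfl, ← this]; exact hPl' _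
  obtain ⟨M, hM⟩ := exists_two_mul_eval_eq hQ
  -- The conic in the new coordinates; passing through the coordinate points kills its diagonal
  -- entries.
  set N : Matrix (Fin 3) (Fin 3) ℂ := Pᵀ * M * P with hN
  have hNx : ∀ x, 2 * eval (P *ᵥ x) Q = x ⬝ᵥ N *ᵥ x := fun x => by
    rw [hM, hN, ← mulVec_mulVec, ← mulVec_mulVec, dotProduct_mulVec x, vecMul_transpose]
  have hNu : ∀ j, u j ⬝ᵥ N *ᵥ u j = 0 := fun j => by rw [← hNx, hPu, hQa, mul_zero]
  have n0 : N 0 0 = 0 := by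
    have := hNu 0
    simp only [h0, mulVec, vec3_dotProduct, cons_val] at this
    simpa using this
  have n1 : N 1 1 = 0 := by
    have := hNu 1
    simp only [h1, mulVec, vec3_dotProduct, cons_val] at this
    simpa using this
  have n2 : N 2 2 = 0 := by
    have := hNu 2
    simp only [h2, mulVec, vec3_dotProduct, cons_val] at this
    simpa using this
  have hNx' : ∀ x, x ⬝ᵥ N *ᵥ x = (N 1 2 + N 2 1) * (x 1 * x 2) + (N 0 2 + N 2 0) * (x 0 * x 2)
      + (N 0 1 + N 1 0) * (x 0 * x 1) := fun x => by
    simp only [mulVec, vec3_dotProduct, n0, n1, n2]; ring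
  have hα : ![N 1 2 + N 2 1, N 0 2 + N 2 0, N 0 1 + N 1 0] ≠ 0 := by
    intro hα
    have e0 := congrFun hα 0
    have e1 := congrFun hα 1
    have e2 := congrFun hα 2
    simp only [cons_val, Pi.zero_apply] at e0 e1 e2
    refine hQ0 (MvPolynomial.funext fun x => ?_)
    have := hNx (P⁻¹ *ᵥ x)
    rw [hPr', hNx', e0, e1, e2] at this
    simpa using this
  have hD := det_cross_cross_eq_zero h0 h1 h2 hα fun j => by
    have := hNu j
    rw [hNx'] at this
    simpa using this
  obtain ⟨m, hm, hm0⟩ := Matrix.exists_mulVec_eq_zero_iff.2 hD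
  refine ⟨P⁻¹ᵀ *ᵥ m, fun h => hm ?_, fun k => ?_⟩
  · have := congrArg (Pᵀ *ᵥ ·) h
    simpa [mulVec_mulVec, ← transpose_mul, hPl] using this
  · set v := c (Fin.castAdd 3 k) ⨯₃ c (Fin.natAdd 3 k) with hv
    have hvl : c (Fin.castAdd 3 k) ⬝ᵥ v = 0 := dot_self_cross _ _
    have hvr : c (Fin.natAdd 3 k) ⬝ᵥ v = 0 := dot_cross_self _ _
    have key : ∀ j, c j ⬝ᵥ v = 0 → (u j ⨯₃ u (j + 1)) ⬝ᵥ (P⁻¹ *ᵥ v) = 0 := fun j hj => by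
      obtain ⟨r, hr, hrσ⟩ := hστ j
      have := hσx j (P⁻¹ *ᵥ v)
      rw [hPr', hj, hrσ, smul_dotProduct, smul_eq_mul] at this
      exact (mul_eq_zero.1 this).resolve_left hr
    have hne : (u (Fin.castAdd 3 k) ⨯₃ u (Fin.castAdd 3 k + 1)) ⨯₃
        (u (Fin.natAdd 3 k) ⨯₃ u (Fin.natAdd 3 k + 1)) ≠ 0 := by
      have hσσ : σ (Fin.castAdd 3 k) ⨯₃ σ (Fin.natAdd 3 k) ≠ 0 :=
        cross_mulVec_ne_zero (P' := P⁻¹ᵀ) (by rw [← transpose_mul, hPr, transpose_one]) (hcc k)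
      obtain ⟨r, hr, hrσ⟩ := hστ (Fin.castAdd 3 k)
      obtain ⟨r', hr', hrσ'⟩ := hστ (Fin.natAdd 3 k)
      intro h
      rw [hrσ, hrσ'] at hσσ
      exact hσσ (by rw [map_smul, map_smul, LinearMap.smul_apply, h]; simp)
    obtain ⟨t, ht⟩ := exists_eq_smul_cross hne (key _ hvl) (key _ hvr)
    have hmk := congrFun hm0 k
    rw [mulVec_transpose, ← dotProduct_mulVec, ht, dotProduct_smul, dotProduct_comm]
    exact (congrArg (t • ·) hmk).trans (smul_zero t)


/-! ### The Pascal line and the weights -/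

namespace IsGenericHexagon

variable {A : Fin 6 → P2} {c : Fin 6 → Fin 3 → ℂ} {g : Fin 3 → Fin 3 → ℂ}

lemma ne_zero (G : IsGenericHexagon A (Sum.elim c g)) (i : Fin 6 ⊕ Fin 3) :
    Sum.elim c g i ≠ 0 := by
  have : Nontrivial (Fin 6 ⊕ Fin 3) := ⟨Sum.inl 0, Sum.inr 0, by simp⟩
  obtain ⟨i', hi'⟩ := exists_ne i
  intro h
  exact G.cross_ne_zero i i' hi'.symm (by simp [h])

lemma side_cross_ne_zero (G : IsGenericHexagon A (Sum.elim c g)) {i i' : Fin 6} (h : i ≠ i') :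
    c i ⨯₃ c i' ≠ 0 :=
  G.cross_ne_zero (Sum.inl i) (Sum.inl i') (Sum.inl_injective.ne h)

lemma side_vertex_eq_zero_iff (G : IsGenericHexagon A (Sum.elim c g)) (i j : Fin 6) :
    c i ⬝ᵥ (A j).rep = 0 ↔ i = j + 5 ∨ i = j := by
  simpa [linesThrough] using G.vertex_mem_iff j (Sum.inl i)

lemma diag_vertex_eq_zero (G : IsGenericHexagon A (Sum.elim c g)) (j : Fin 6) :
    g (diagIndex j) ⬝ᵥ (A j).rep = 0 :=
  (G.vertex_mem_iff j (Sum.inr (diagIndex j))).2 (by simp [linesThrough])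

/-- No three sides are concurrent. -/
lemma side_ne_zero_of_sides_eq_zero (G : IsGenericHexagon A (Sum.elim c g)) {v : Fin 3 → ℂ}
    (hv : v ≠ 0) {i₁ i₂ i₃ : Fin 6} (h12 : i₁ ≠ i₂) (h13 : i₁ ≠ i₃) (h23 : i₂ ≠ i₃)
    (h1 : c i₁ ⬝ᵥ v = 0) (h2 : c i₂ ⬝ᵥ v = 0) : c i₃ ⬝ᵥ v ≠ 0 := by
  intro h3
  obtain ⟨j, r, hr, rfl⟩ := G.eq_vertex v hv (Sum.inl i₁) (Sum.inl i₂) (Sum.inl i₃)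
    (by simpa using h12) (by simpa using h13) (by simpa using h23) h1 h2 h3
  simp only [dotProduct_smul, smul_eq_mul, mul_eq_zero, hr, false_or,
    G.side_vertex_eq_zero_iff] at h1 h2 h3
  -- Only two sides pass through a vertex, so two of the three indices coincide.
  rcases h1 with rfl | rfl <;> rcases h2 with rfl | rfl <;> rcases h3 with rfl | rfl <;>
    simp_all

/-- The three diagonals are not concurrent. -/
lemma eq_zero_of_diagonals_eq_zero (G : IsGenericHexagon A (Sum.elim c g)) {v : Fin 3 → ℂ}
    (h : ∀ k, g k ⬝ᵥ v = 0) : v = 0 := by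
  by_contra hv
  obtain ⟨j, r, hr, rfl⟩ := G.eq_vertex v hv (Sum.inr 0) (Sum.inr 1) (Sum.inr 2)
    (by simp) (by simp) (by simp) (h 0) (h 1) (h 2)
  have hk : ∀ k, k = diagIndex j := fun k => by
    have := h k
    rw [dotProduct_smul, smul_eq_mul, mul_eq_zero, or_iff_right hr] at this
    simpa [linesThrough] using (G.vertex_mem_iff j (Sum.inr k)).1 this
  exact absurd ((hk 0).trans (hk 1).symm) (by decide)

/-- The equation of the Pascal line is a combination with nonzero coefficients of the equations of
each pair of opposite sides. -/
lemma exists_weights (G : IsGenericHexagon A (Sum.elim c g)) {m : Fin 3 → ℂ} (hm : m ≠ 0)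
    (h : ∀ k : Fin 3, m ⬝ᵥ c (Fin.castAdd 3 k) ⨯₃ c (Fin.natAdd 3 k) = 0) :
    ∃ ρ : Fin 6 → ℂ, (∀ j, ρ j ≠ 0) ∧ ∀ j, m = ρ j • c j + ρ (j + 3) • c (j + 3) := by
  have hne : ∀ k : Fin 3, (Fin.castAdd 3 k : Fin 6) ≠ Fin.natAdd 3 k := by decide
  have hx : ∀ k : Fin 3, ∃ x y : ℂ,
      m = x • c (Fin.castAdd 3 k) + y • c (Fin.natAdd 3 k) ∧ x ≠ 0 ∧ y ≠ 0 := by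
    intro k
    obtain ⟨x, y, hxy⟩ := exists_eq_add_of_dotProduct_cross_eq_zero
      (G.side_cross_ne_zero (hne k)) (h k)
    -- `m` is not a multiple of a side outside the pair `k + 1`: such a side would pass through that
    -- pair's intersection, giving three concurrent sides.
    have hside : ∀ i : Fin 6, i ≠ Fin.castAdd 3 (k + 1) → i ≠ Fin.natAdd 3 (k + 1) →
        ∀ z : ℂ, m ≠ z • c i := by
      intro i hi hi' z hz
      have hv := G.side_cross_ne_zero (hne (k + 1))
      have h3 := G.side_ne_zero_of_sides_eq_zero hv (hne (k + 1)) hi.symm hi'.symm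
        (dot_self_cross _ _) (dot_cross_self _ _)
      have h4 := h (k + 1)
      rw [hz, smul_dotProduct, smul_eq_mul, mul_eq_zero] at h4
      rcases h4 with rfl | h4
      · exact hm (by simp [hz])
      · exact h3 h4
    refine ⟨x, y, hxy, ?_, ?_⟩
    · rintro rfl
      refine hside (Fin.natAdd 3 k) ?_ ?_ y (by simpa using hxy) <;> clear hxy hside <;> revert k <;> decide
    · rintro rfl
      refine hside (Fin.castAdd 3 k) ?_ ?_ x (by simpa using hxy) <;> clear hxy hside <;> revert k <;> decide
  choose x y hxy hx0 hy0 using hx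
  refine ⟨![x 0, x 1, x 2, y 0, y 1, y 2], fun j => ?_, fun j => ?_⟩
  · fin_cases j
    exacts [hx0 0, hx0 1, hx0 2, hy0 0, hy0 1, hy0 2]
  · fin_cases j
    exacts [hxy 0, hxy 1, hxy 2, (hxy 0).trans (add_comm _ _), (hxy 1).trans (add_comm _ _),
      (hxy 2).trans (add_comm _ _)]

/-- Equating the expressions of `m` at `j` and `j + 5` writes one form as a difference of the sides
at `A j` and also of the sides at `A (j + 3)`. It vanishes at both vertices, hence defines the
diagonal. -/
lemma diag_eq_smul (G : IsGenericHexagon A (Sum.elim c g)) (hA : Function.Injective A)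
    {m : Fin 3 → ℂ} {ρ : Fin 6 → ℂ} (hρ : ∀ j, ρ j ≠ 0)
    (hm : ∀ j, m = ρ j • c j + ρ (j + 3) • c (j + 3)) (j : Fin 6) :
    ∃ γ : ℂ, g (diagIndex j) = γ • (ρ j • c j - ρ (j + 5) • c (j + 5)) := by
  have e1 : j + 5 + 3 = j + 2 := by revert j; decide
  have e2 : j + 2 = j + 3 + 5 := by revert j; decide
  have e3 : diagIndex (j + 3) = diagIndex j := by revert j; decide
  have e4 : j ≠ j + 3 := by revert j; decide
  have e5 : j ≠ j + 5 := by revert j; decide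
  have hopp : ρ j • c j - ρ (j + 5) • c (j + 5) =
      ρ (j + 2) • c (j + 2) - ρ (j + 3) • c (j + 3) := by
    have h1 := hm j
    have h2 := hm (j + 5)
    rw [e1, h1] at h2
    rw [sub_eq_sub_iff_add_eq_add, h2, add_comm]
  refine exists_eq_smul_of_vanish (cross_rep_ne_zero (hA.ne e4)) ?_ ?_ ?_
    (G.diag_vertex_eq_zero j) (e3 ▸ G.diag_vertex_eq_zero (j + 3))
  · intro h0
    have := congrArg (fun z => z ⨯₃ c (j + 5)) h0
    simp only [map_sub, LinearMap.sub_apply, map_smul, LinearMap.smul_apply, cross_self,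
      smul_zero, sub_zero, map_zero, LinearMap.zero_apply] at this
    exact (smul_ne_zero (hρ j) (G.side_cross_ne_zero e5)) this
  · rw [sub_dotProduct, smul_dotProduct, smul_dotProduct,
      (G.side_vertex_eq_zero_iff j j).2 (Or.inr rfl),
      (G.side_vertex_eq_zero_iff (j + 5) j).2 (Or.inl rfl)]
    simp
  · rw [hopp, sub_dotProduct, smul_dotProduct, smul_dotProduct,
      (G.side_vertex_eq_zero_iff (j + 3) (j + 3)).2 (Or.inr rfl),
      (G.side_vertex_eq_zero_iff (j + 2) (j + 3)).2 (Or.inl e2)]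
    simp

/-- The reciprocals of the coefficients of the sides in the equation of the Pascal line, together
with zero on the diagonals, are locally the derivatives of the equations of the lines. -/
lemma exists_dotProduct_eq_weight (G : IsGenericHexagon A (Sum.elim c g))
    (hA : Function.Injective A) {m : Fin 3 → ℂ} {ρ : Fin 6 → ℂ} (hρ : ∀ j, ρ j ≠ 0)
    (hm : ∀ j, m = ρ j • c j + ρ (j + 3) • c (j + 3)) {v : Fin 3 → ℂ} (hv : v ≠ 0) :
    ∃ t : Fin 3 → ℂ, ∀ i, Sum.elim c g i ⬝ᵥ v = 0 →
      Sum.elim c g i ⬝ᵥ t = Sum.elim (fun j => (ρ j)⁻¹) 0 i := by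
  set w := Sum.elim c g with hw
  set e : Fin 6 ⊕ Fin 3 → ℂ := Sum.elim (fun j => (ρ j)⁻¹) 0 with he
  have hpair : ∀ a b, a ≠ b → (∀ i, w i ⬝ᵥ v = 0 → i = a ∨ i = b) →
      ∃ t : Fin 3 → ℂ, ∀ i, w i ⬝ᵥ v = 0 → w i ⬝ᵥ t = e i := by
    intro a b hab h
    obtain ⟨t, ha, hb⟩ := exists_dotProduct_eq (G.cross_ne_zero a b hab) (e a) (e b)
    refine ⟨t, fun i hi => ?_⟩
    rcases h i hi with rfl | rfl <;> assumption
  by_cases h1 : ∃ a, w a ⬝ᵥ v = 0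
  · obtain ⟨a, ha⟩ := h1
    by_cases h2 : ∃ b, b ≠ a ∧ w b ⬝ᵥ v = 0
    · obtain ⟨b, hba, hb⟩ := h2
      by_cases h3 : ∃ i, i ≠ a ∧ i ≠ b ∧ w i ⬝ᵥ v = 0
      · obtain ⟨i, hia, hib, hi⟩ := h3
        obtain ⟨j, r, hr, rfl⟩ := G.eq_vertex v hv a b i hba.symm hia.symm hib.symm ha hb hi
        have e5 : j + 5 ≠ j := by simp
        obtain ⟨t, ht5, ht⟩ := exists_dotProduct_eq (G.side_cross_ne_zero e5)
          (ρ (j + 5))⁻¹ (ρ j)⁻¹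
        refine ⟨t, fun i' hi' => ?_⟩
        rw [dotProduct_smul, smul_eq_mul, mul_eq_zero, or_iff_right hr, G.vertex_mem_iff] at hi'
        simp only [linesThrough, Finset.mem_insert, Finset.mem_singleton] at hi'
        rcases hi' with rfl | rfl | rfl
        · exact ht5
        · exact ht
        · obtain ⟨γ, hγ⟩ := G.diag_eq_smul hA hρ hm j
          simp [hw, he, hγ, sub_dotProduct, ht, ht5, hρ]
      · push Not at h3
        refine hpair a b hba.symm fun i hi => ?_
        by_contra hc
        push Not at hc
        exact h3 i hc.1 hc.2 hi
    · push Not at h2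
      -- Only one line passes through `v`; an arbitrary second index lets `hpair` apply.
      have : Nontrivial (Fin 6 ⊕ Fin 3) := ⟨Sum.inl 0, Sum.inr 0, by simp⟩
      obtain ⟨b, hb⟩ := exists_ne a
      refine hpair a b hb.symm fun i hi => Or.inl ?_
      by_contra hc
      exact h2 i hc hi
  · push Not at h1
    exact ⟨0, fun i hi => absurd hi (h1 i)⟩

end IsGenericHexagon

/-! ### The quartic and the octic -/

/-- The quartic attached to a hexagon with sides `c j` and weights `e j`. -/
def hexagonQuartic (c : Fin 6 → Fin 3 → ℂ) (e : Fin 6 → ℂ) : S :=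
  C (e 0 * e 3) * (linForm (c 1) * linForm (c 2) * linForm (c 4) * linForm (c 5)) +
  C (e 1 * e 4) * (linForm (c 0) * linForm (c 2) * linForm (c 3) * linForm (c 5)) +
  C (e 2 * e 5) * (linForm (c 0) * linForm (c 1) * linForm (c 3) * linForm (c 4))

lemma isHomogeneous_hexagonQuartic (c : Fin 6 → Fin 3 → ℂ) (e : Fin 6 → ℂ) :
    (hexagonQuartic c e).IsHomogeneous 4 := by
  have h := fun j => isHomogeneous_linForm (c j)
  have h4 : ∀ (a : ℂ) i j k l, (C a * (linForm (c i) * linForm (c j) * linForm (c k) *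
      linForm (c l))).IsHomogeneous 4 := fun a i j k l => by
    simpa using (isHomogeneous_C _ a).mul ((((h i).mul (h j)).mul (h k)).mul (h l))
  exact ((h4 _ _ _ _ _).add (h4 _ _ _ _ _)).add (h4 _ _ _ _ _)

/-- The quartic vanishes at the intersection of two sides which are not opposite. -/
lemma eval_hexagonQuartic_eq_zero {c : Fin 6 → Fin 3 → ℂ} {e : Fin 6 → ℂ} {v : Fin 3 → ℂ}
    {i j : Fin 6} (hij : i ≠ j) (hij' : i ≠ j + 3) (hi : c i ⬝ᵥ v = 0) (hj : c j ⬝ᵥ v = 0) :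
    eval v (hexagonQuartic c e) = 0 := by
  simp only [hexagonQuartic, map_add, map_mul, eval_linForm]
  fin_cases i <;> fin_cases j <;>
    simp only [Fin.zero_eta, Fin.mk_one, Fin.reduceFinMk] at hi hj hij hij' <;>
    first
    | exact absurd rfl hij
    | exact absurd rfl hij'
    | simp [hi, hj]

/-- The terms of opposite sides combine through `k0`, `k1`, `k2`: each bracket is `m` times the
product of the two weights. -/
lemma sum_weights_eq {c : Fin 6 → Fin 3 → ℂ} (g : Fin 3 → Fin 3 → ℂ) {m : Fin 3 → ℂ}
    {ρ : Fin 6 → ℂ} (hρ : ∀ j, ρ j ≠ 0) (hm : ∀ j, m = ρ j • c j + ρ (j + 3) • c (j + 3)) :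
    linForm m * linForm (g 0) * linForm (g 1) * linForm (g 2) *
        hexagonQuartic c (fun j => (ρ j)⁻¹) =
      ∑ i, C (Sum.elim (fun j => (ρ j)⁻¹) 0 i) *
        ∏ j ∈ Finset.univ.erase i, linForm (Sum.elim c g j) := by
  have herase : ∀ j : Fin 6, (Finset.univ.erase (Sum.inl j) : Finset (Fin 6 ⊕ Fin 3)) =
      (Finset.univ.erase j).disjSum Finset.univ := by decide
  have hl : ∀ j, linForm m = C (ρ j) * linForm (c j) + C (ρ (j + 3)) * linForm (c (j + 3)) :=
    fun j => by rw [hm j, linForm_add, linForm_smul, linForm_smul]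
  have hC : ∀ j, C (ρ j)⁻¹ * C (ρ j) = (1 : S) := fun j => by
    rw [← C_mul, inv_mul_cancel₀ (hρ j), C_1]
  have u0 : (Finset.univ.erase (0 : Fin 6)) = {1, 2, 3, 4, 5} := by decide
  have u1 : (Finset.univ.erase (1 : Fin 6)) = {0, 2, 3, 4, 5} := by decide
  have u2 : (Finset.univ.erase (2 : Fin 6)) = {0, 1, 3, 4, 5} := by decide
  have u3 : (Finset.univ.erase (3 : Fin 6)) = {0, 1, 2, 4, 5} := by decide
  have u4 : (Finset.univ.erase (4 : Fin 6)) = {0, 1, 2, 3, 5} := by decide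
  have u5 : (Finset.univ.erase (5 : Fin 6)) = {0, 1, 2, 3, 4} := by decide
  have h0 : linForm m = C (ρ 0) * linForm (c 0) + C (ρ 3) * linForm (c 3) := hl 0
  have h1 : linForm m = C (ρ 1) * linForm (c 1) + C (ρ 4) * linForm (c 4) := hl 1
  have h2 : linForm m = C (ρ 2) * linForm (c 2) + C (ρ 5) * linForm (c 5) := hl 2
  have k0 : linForm m * (C (ρ 0)⁻¹ * C (ρ 3)⁻¹) =
      C (ρ 0)⁻¹ * linForm (c 3) + C (ρ 3)⁻¹ * linForm (c 0) := by
    rw [h0]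
    linear_combination C (ρ 3)⁻¹ * linForm (c 0) * hC 0 + C (ρ 0)⁻¹ * linForm (c 3) * hC 3
  have k1 : linForm m * (C (ρ 1)⁻¹ * C (ρ 4)⁻¹) =
      C (ρ 1)⁻¹ * linForm (c 4) + C (ρ 4)⁻¹ * linForm (c 1) := by
    rw [h1]
    linear_combination C (ρ 4)⁻¹ * linForm (c 1) * hC 1 + C (ρ 1)⁻¹ * linForm (c 4) * hC 4
  have k2 : linForm m * (C (ρ 2)⁻¹ * C (ρ 5)⁻¹) =
      C (ρ 2)⁻¹ * linForm (c 5) + C (ρ 5)⁻¹ * linForm (c 2) := by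
    rw [h2]
    linear_combination C (ρ 5)⁻¹ * linForm (c 2) * hC 2 + C (ρ 2)⁻¹ * linForm (c 5) * hC 5
  simp only [Fintype.sum_sum_type, Sum.elim_inl, Sum.elim_inr, Pi.zero_apply, C_0, zero_mul,
    Finset.sum_const_zero, add_zero, herase, Finset.prod_disjSum, Fin.sum_univ_six,
    Fin.prod_univ_three, u0, u1, u2, u3, u4, u5]
  simp only [Finset.prod_insert, Finset.mem_insert, Finset.mem_singleton, Fin.reduceEq, or_self,
    not_false_eq_true, Finset.prod_singleton, hexagonQuartic, C_mul]
  linear_combination linForm (g 0) * linForm (g 1) * linForm (g 2) *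
    (linForm (c 1) * linForm (c 2) * linForm (c 4) * linForm (c 5) * k0 +
      linForm (c 0) * linForm (c 2) * linForm (c 3) * linForm (c 5) * k1 +
      linForm (c 0) * linForm (c 1) * linForm (c 3) * linForm (c 4) * k2)

namespace IsGenericHexagon

variable {A : Fin 6 → P2} {c : Fin 6 → Fin 3 → ℂ} {g : Fin 3 → Fin 3 → ℂ}

/-- At the intersection of sides 0 and 3 only the first summand survives, and no other side passes
there. -/
lemma hexagonQuartic_ne_zero (G : IsGenericHexagon A (Sum.elim c g)) {e : Fin 6 → ℂ}
    (he : ∀ j, e j ≠ 0) : hexagonQuartic c e ≠ 0 := by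
  intro h
  have hv := G.side_cross_ne_zero (show (0 : Fin 6) ≠ 3 by decide)
  have h0 : c 0 ⬝ᵥ c 0 ⨯₃ c 3 = 0 := dot_self_cross _ _
  have h3 : c 3 ⬝ᵥ c 0 ⨯₃ c 3 = 0 := dot_cross_self _ _
  have hne : ∀ i : Fin 6, i ≠ 0 → i ≠ 3 → c i ⬝ᵥ c 0 ⨯₃ c 3 ≠ 0 := fun i hi hi' =>
    G.side_ne_zero_of_sides_eq_zero hv (by decide) hi.symm hi'.symm h0 h3
  have := congrArg (eval (c 0 ⨯₃ c 3)) h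
  simp only [hexagonQuartic, map_add, map_mul, eval_linForm, eval_C, h0, zero_mul, mul_zero,
    add_zero, map_zero, mul_eq_zero, he, false_or] at this
  rcases this with ((h | h) | h) | h
  exacts [hne 1 (by decide) (by decide) h, hne 2 (by decide) (by decide) h,
    hne 4 (by decide) (by decide) h, hne 5 (by decide) (by decide) h]

/-- Only divisibility by the three diagonals matters: it forces the direction of differentiation to
be zero. -/
lemma not_mem_jacobianIdeal (G : IsGenericHexagon A (Sum.elim c g)) {m : Fin 3 → ℂ} (hm : m ≠ 0)
    {q : S} (hq : q ≠ 0) (hq4 : q.IsHomogeneous 4) :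
    linForm m * linForm (g 0) * linForm (g 1) * linForm (g 2) * q ∉
      jacobianIdeal (∏ i, linForm (Sum.elim c g i)) := by
  intro h
  have hg := fun k => isHomogeneous_linForm (g k)
  obtain ⟨t, ht⟩ := exists_eq_dirDeriv_of_mem_jacobianIdeal (n := 8)
    (isHomogeneous_prod_linForm (Sum.elim c g) Finset.univ)
    (((((isHomogeneous_linForm m).mul (hg 0)).mul (hg 1)).mul (hg 2)).mul hq4) h
  have hdvd : ∀ k, linForm (g k) ∣
      linForm m * linForm (g 0) * linForm (g 1) * linForm (g 2) * q := fun k => by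
    fin_cases k
    exacts [⟨linForm m * linForm (g 1) * linForm (g 2) * q, by simp only [Fin.zero_eta]; ring⟩,
      ⟨linForm m * linForm (g 0) * linForm (g 2) * q, by simp only [Fin.mk_one]; ring⟩,
      ⟨linForm m * linForm (g 0) * linForm (g 1) * q, by simp only [Fin.reduceFinMk]; ring⟩]
  have ht0 : t = 0 := G.eq_zero_of_diagonals_eq_zero fun k =>
    dotProduct_eq_zero_of_dvd_dirDeriv (i := Sum.inr k) (G.ne_zero _)
      (fun j hj => G.cross_ne_zero _ _ hj.symm) (ht ▸ hdvd k)
  have hg0 : ∀ k, linForm (g k) ≠ 0 := fun k h => G.ne_zero (Sum.inr k) (linForm_eq_zero_iff.1 h)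
  have hm0 : linForm m ≠ 0 := fun h => hm (linForm_eq_zero_iff.1 h)
  have hz : dirDeriv 0 (∏ i, linForm (Sum.elim c g i)) = 0 := by simp [dirDeriv_eq_sum]
  rw [ht0, hz] at ht
  simp [hg0, hm0, hq] at ht

end IsGenericHexagon

/-! ### From curves to coordinates, and the theorem -/

lemma isPascalLine_linForm_iff {c : Fin 6 → Fin 3 → ℂ}
    (hc : ∀ k : Fin 3, c (Fin.castAdd 3 k) ⨯₃ c (Fin.natAdd 3 k) ≠ 0) {m : Fin 3 → ℂ}
    (hm : m ≠ 0) :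
    IsPascalLine (fun j => linForm (c j)) (linForm m) ↔
      ∀ k : Fin 3, m ⬝ᵥ c (Fin.castAdd 3 k) ⨯₃ c (Fin.natAdd 3 k) = 0 := by
  refine ⟨fun h k => ?_, fun h => ⟨isLineForm_linForm hm, fun k p hp => ?_⟩⟩
  · have hmem : ∀ a : Fin 3 → ℂ, Projectivization.mk ℂ _ (hc k) ∈ curve (linForm a) ↔
        a ⬝ᵥ c (Fin.castAdd 3 k) ⨯₃ c (Fin.natAdd 3 k) = 0 := fun a => by
      rw [mk_mem_curve_iff (isHomogeneous_linForm a), eval_linForm]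
    exact (hmem m).1 (h.2 k ⟨(hmem _).2 (dot_self_cross _ _), (hmem _).2 (dot_cross_self _ _)⟩)
  · obtain ⟨h1, h2⟩ := hp
    rw [mem_curve_linForm] at h1 h2 ⊢
    obtain ⟨r, hr⟩ := exists_eq_smul_cross (hc k) h1 h2
    rw [hr, dotProduct_smul, h k, smul_zero]

/-- Pascal's theorem needs only a nonzero quadratic form; the zero form is not smooth, as all its
partials vanish everywhere. -/
lemma isHomogeneous_and_ne_zero_of_conic {Q : S} (hQ : IsSmoothConic Q ∨ IsTwoLines Q) :
    Q.IsHomogeneous 2 ∧ Q ≠ 0 := by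
  rcases hQ with ⟨h2, hQ⟩ | ⟨m, n, hm, hn, -, rfl⟩
  · refine ⟨h2, ?_⟩
    rintro rfl
    have h1 : (1 : Fin 3 → ℂ) ≠ 0 := one_ne_zero
    obtain ⟨i, hi⟩ := hQ (Projectivization.mk ℂ 1 h1) fun v _ _ => map_zero _
    exact hi fun v _ _ => by simp
  · exact ⟨hm.1.mul hn.1, mul_ne_zero hm.2 hn.2⟩

end Hexagon
end

open Hexagon MvPolynomial Matrix in
theorem theorem1p4
    -- the vertices of the hexagon; indices start at 0 and are cyclic modulo 6
    (A : Fin 6 → Hexagon.P2) (hA : Function.Injective A)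
    -- equations of the sides, `s j = 0` being the line through `A j` and `A (j + 1)`
    (s : Fin 6 → Hexagon.S) (hs : ∀ j, Hexagon.IsLineForm (s j))
    (hsA : ∀ j, A j ∈ Hexagon.curve (s j) ∧ A (j + 1) ∈ Hexagon.curve (s j))
    -- equations of the diagonals, `d k = 0` being the line through `A k` and `A (3 + k)`
    (d : Fin 3 → Hexagon.S) (hd : ∀ k, Hexagon.IsLineForm (d k))
    (hdA : ∀ k : Fin 3, A (Fin.castAdd 3 k) ∈ Hexagon.curve (d k) ∧
      A (Fin.natAdd 3 k) ∈ Hexagon.curve (d k))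
    -- the vertices lie on a conic which is smooth or a union of two distinct lines
    (hconic : ∃ Q : Hexagon.S, (Hexagon.IsSmoothConic Q ∨ Hexagon.IsTwoLines Q) ∧
      ∀ j, A j ∈ Hexagon.curve Q)
    -- the arrangement of the sides and diagonals has exactly 6 triple and 18 double points
    (htriple : (Hexagon.multiplePoints (Sum.elim s d) 3).ncard = 6)
    (hdouble : (Hexagon.multiplePoints (Sum.elim s d) 2).ncard = 18) :
    (∃ l : Hexagon.S, Hexagon.IsPascalLine s l) ∧
    ∀ l : Hexagon.S, Hexagon.IsPascalLine s l →
      ∃ q : Hexagon.S, q ≠ 0 ∧ q.IsHomogeneous 4 ∧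
        (∀ j, A j ∈ Hexagon.curve q) ∧
        (∀ j, Hexagon.curve (s j) ∩ Hexagon.curve (s (j + 2)) ⊆ Hexagon.curve q) ∧
        l * d 0 * d 1 * d 2 * q ∈ Hexagon.degreePart
          (Hexagon.saturation (Hexagon.jacobianIdeal ((∏ j, s j) * ∏ k, d k))) 8 ∧
        l * d 0 * d 1 * d 2 * q ∉ Hexagon.degreePart
          (Hexagon.jacobianIdeal ((∏ j, s j) * ∏ k, d k)) 8 := by
  choose c hc hsc using fun j => (hs j).exists_eq_linForm
  choose g hg hdg using fun k => (hd k).exists_eq_linForm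
  obtain rfl : s = fun j => linForm (c j) := funext hsc
  obtain rfl : d = fun k => linForm (g k) := funext hdg
  have hw : (Sum.elim (fun j => linForm (c j)) fun k => linForm (g k)) =
      fun i => linForm (Sum.elim c g i) := by
    funext i; cases i <;> rfl
  rw [hw] at htriple hdouble
  have hF : (∏ j, linForm (c j)) * ∏ k, linForm (g k) = ∏ i, linForm (Sum.elim c g i) := by
    rw [Fintype.prod_sum_type]; rfl
  have G : IsGenericHexagon A (Sum.elim c g) := by
    refine isGenericHexagon A hA _ (by rintro (j | k); exacts [hc j, hg k]) ?_ htriple hdouble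
    intro j i hi
    simp only [linesThrough, Finset.mem_insert, Finset.mem_singleton] at hi
    rcases hi with rfl | rfl | rfl
    · have e : j + 5 + 1 = j := by revert j; decide
      have := (hsA (j + 5)).2
      rwa [e] at this
    · exact (hsA j).1
    · have e : j = Fin.castAdd 3 (diagIndex j) ∨ j = Fin.natAdd 3 (diagIndex j) := by
        revert j; decide
      rcases e with e | e
      · have := (hdA (diagIndex j)).1
        rwa [← e] at this
      · have := (hdA (diagIndex j)).2
        rwa [← e] at this
  have hopp : ∀ k : Fin 3, c (Fin.castAdd 3 k) ⨯₃ c (Fin.natAdd 3 k) ≠ 0 := fun k =>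
    G.side_cross_ne_zero (show (Fin.castAdd 3 k : Fin 6) ≠ Fin.natAdd 3 k by revert k; decide)
  refine ⟨?_, fun l hl => ?_⟩
  · obtain ⟨Q, hQ, hQA⟩ := hconic
    obtain ⟨hQ2, hQ0⟩ := isHomogeneous_and_ne_zero_of_conic hQ
    obtain ⟨m, hm, hmc⟩ := exists_dotProduct_cross_eq_zero (a := fun j => (A j).rep) hQ2 hQ0
      (fun j => (mem_curve_iff hQ2).1 (hQA j)) (fun j => mem_curve_linForm.1 (hsA j).1)
      (fun j => mem_curve_linForm.1 (hsA j).2)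
      (fun j => cross_rep_ne_zero (hA.ne (by revert j; decide))) hc hopp
      (by rw [Ne, G.side_vertex_eq_zero_iff]; decide)
    exact ⟨linForm m, (isPascalLine_linForm_iff hopp hm).2 hmc⟩
  · obtain ⟨m, hm, rfl⟩ := hl.1.exists_eq_linForm
    obtain ⟨ρ, hρ, hmρ⟩ := G.exists_weights hm ((isPascalLine_linForm_iff hopp hm).1 hl)
    have hq4 := isHomogeneous_hexagonQuartic c fun j => (ρ j)⁻¹
    have hq0 := G.hexagonQuartic_ne_zero (e := fun j => (ρ j)⁻¹) fun j => inv_ne_zero (hρ j)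
    have hg1 := fun k => isHomogeneous_linForm (g k)
    refine ⟨_, hq0, hq4, fun j => ?_, fun j p hp => ?_, ⟨?_, ?_⟩, fun h => ?_⟩
    · rw [mem_curve_iff hq4]
      exact eval_hexagonQuartic_eq_zero (i := j + 5) (j := j) (by revert j; decide)
        (by revert j; decide) ((G.side_vertex_eq_zero_iff _ j).2 (Or.inl rfl))
        ((G.side_vertex_eq_zero_iff _ j).2 (Or.inr rfl))
    · rw [mem_curve_iff hq4]
      exact eval_hexagonQuartic_eq_zero (i := j) (j := j + 2) (by simp)
        (by clear hp; revert j; decide) (mem_curve_linForm.1 hp.1) (mem_curve_linForm.1 hp.2)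
    · rw [hF, sum_weights_eq g hρ hmρ]
      exact sum_mul_prod_erase_mem_saturation _ _ fun v hv =>
        G.exists_dotProduct_eq_weight hA hρ hmρ hv
    · exact ((((isHomogeneous_linForm m).mul (hg1 0)).mul (hg1 1)).mul (hg1 2)).mul hq4
    · rw [hF] at h
      exact G.not_mem_jacobianIdeal hm hq0 hq4 h.1
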